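/- Let $H$ be a complex separable Hilbert space (finite or countably infinite dimensional), $L(H)$ its bounded operators and $T(H)$ its trace class operators. A (discrete) observable is a finite or countably infinite family $\mathsf A=(\mathsf A_x)_{x\in\Omega_{\mathsf A}}$ of positive operators in $L(H)$ with $\sum_x \mathsf A_x=\mathbb 1$ (weakly). Two observables $\mathsf A,\mathsf B$ commute if $\mathsf A_x\mathsf B_y=\mathsf B_y\mathsf A_x$ for all $x,y$. An instrument implementing $\mathsf A$ is a family $(\mathcal I_x)_{x\in\Omega_{\mathsf A}}$ of completely positive linear maps on $T(H)$ with $\mathcal I_x^*(\mathbb 1)=\mathsf A_x$ for all $x$, the adjoint being taken with respect to the trace duality $\mathrm{tr}[X\,\mathcal I_x(Y)]=\mathrm{tr}[\mathcal I_x^*(X)\,Y]$; that is, $\mathrm{tr}[\mathcal I_x(Y)]=\mathrm{tr}[\mathsf A_xY]$ for all $Y\in T(H)$. We say that $\mathsf A$ can be measured without disturbing $\mathsf B$ if there is an instrument $(\mathcal I_x)$ implementing $\mathsf A$ such that, with $\mathcal I(\varrho)=\sum_x\mathcal I_x(\varrho)$ (convergence in trace norm), $$\mathrm{tr}[\mathcal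 I(\varrho)\mathsf B_y]=\mathrm{tr}[\varrho\,\mathsf B_y]$$ for every state $\varrho$ (positive operator in $T(H)$ of trace one) and every $y\in\Omega_{\mathsf B}$. **Proposition.** Let $\mathsf B$ be an observable on $H$ such that for every $y\in\Omega_{\mathsf B}$ the operator $\mathsf B_y^2$ belongs to the closure, in the $\sigma$-weak topology of $L(H)$ (the coarsest topology making $X\mapsto \mathrm{tr}[\varrho X]$ continuous for every $\varrho\in T(H)$), of the complex linear span of $\{\mathsf B_y: y\in\Omega_{\mathsf B}\}$. Then, for every observable $\mathsf A$ on $H$, $\mathsf A$ can be measured without disturbing $\mathsf B$ if and only if $\mathsf A$ and $\mathsf B$ commute. -/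

import Mathlib

namespace QMeas

noncomputable section

open Filter Topology
open scoped ComplexOrder

variable {H : Type*} [NormedAddCommGroup H] [InnerProductSpace ℂ H] [CompleteSpace H]

/-! ### Trace class operators, trace and trace norm -/

/-- `T = ∑ₙ |xₙ⟩⟨yₙ|` with `∑ₙ ‖xₙ‖ ‖yₙ‖ < ∞`. -/
def IsNuclearRep (T : H →L[ℂ] H) (x y : ℕ → H) : Prop :=
  Summable (fun n => ‖x n‖ * ‖y n‖) ∧ ∀ v : H, HasSum (fun n => inner ℂ (y n) v • x n) (T v)

/-- The trace class operators on a Hilbert space: the nuclear operators, that is, the absolutely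
convergent sums of rank one operators, as a linear subspace of the bounded operators. -/
def traceClass (H : Type*) [NormedAddCommGroup H] [InnerProductSpace ℂ H] [CompleteSpace H] :
    Submodule ℂ (H →L[ℂ] H) where
  carrier := {T | ∃ x y : ℕ → H, IsNuclearRep T x y}
  zero_mem' := ⟨0, 0, by simp [summable_zero], by simp [hasSum_zero]⟩
  add_mem' := by
    rintro S T ⟨x, y, h1, h2⟩ ⟨x', y', h1', h2'⟩
    let e := Equiv.natSumNatEquivNat
    refine ⟨Sum.elim x x' ∘ e.symm, Sum.elim y y' ∘ e.symm, ?_, fun v => ?_⟩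
    · refine (e.symm.summable_iff
        (f := fun k : ℕ ⊕ ℕ => ‖Sum.elim x x' k‖ * ‖Sum.elim y y' k‖)).2 ?_
      exact (HasSum.sum (f := fun k : ℕ ⊕ ℕ => ‖Sum.elim x x' k‖ * ‖Sum.elim y y' k‖)
        h1.hasSum h1'.hasSum).summable
    · refine (e.symm.hasSum_iff
        (f := fun k : ℕ ⊕ ℕ => inner ℂ (Sum.elim y y' k) v • Sum.elim x x' k)).2 ?_
      exact HasSum.sum (by simpa [Function.comp_def] using h2 v)
        (by simpa [Function.comp_def] using h2' v)
  smul_mem' := by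
    rintro c T ⟨x, y, h1, h2⟩
    refine ⟨fun n => c • x n, y, ?_, fun v => ?_⟩
    · simpa [norm_smul, mul_assoc] using h1.mul_left ‖c‖
    · simpa [smul_comm c] using (h2 v).const_smul c

/-- The trace norm: the infimum of `∑ₙ ‖xₙ‖ ‖yₙ‖` over all representations
`T = ∑ₙ |xₙ⟩⟨yₙ|`; it equals the trace of `|T|`. -/
def traceNorm (T : traceClass H) : ℝ :=
  sInf {r : ℝ | ∃ x y : ℕ → H, IsNuclearRep (T : H →L[ℂ] H) x y ∧ r = ∑' n, ‖x n‖ * ‖y n‖}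

/-- A Hilbert space has an orthonormal basis; we fix one. -/
def onb (H : Type*) [NormedAddCommGroup H] [InnerProductSpace ℂ H] [CompleteSpace H] :
    HilbertBasis (exists_hilbertBasis ℂ H).choose ℂ H :=
  (exists_hilbertBasis ℂ H).choose_spec.choose

/-- The trace `∑ᵢ ⟨eᵢ, T eᵢ⟩`. It is only used for trace class operators `T`, for which the sum
converges absolutely and does not depend on the orthonormal basis. -/
def trace (T : H →L[ℂ] H) : ℂ := ∑' i, inner ℂ (onb H i) (T (onb H i))

/-- States (density operators): positive trace class operators of trace one. -/
def IsState (ρ : traceClass H) : Prop :=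
  (ρ : H →L[ℂ] H).IsPositive ∧ trace (ρ : H →L[ℂ] H) = 1

/-- Unconditional convergence `∑ₓ fₓ = σ` in trace norm. -/
def HasTraceNormSum {Ω : Type*} (f : Ω → traceClass H) (σ : traceClass H) : Prop :=
  Tendsto (fun s : Finset Ω => traceNorm (σ - ∑ x ∈ s, f x)) atTop (𝓝 0)

/-- The σ-weak topology on the bounded operators: the coarsest topology for which all functionals
`X ↦ tr (ρ X)` with `ρ` trace class are continuous. -/
abbrev sigmaWeakTopology (H : Type*) [NormedAddCommGroup H] [InnerProductSpace ℂ H]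
    [CompleteSpace H] : TopologicalSpace (H →L[ℂ] H) :=
  ⨅ ρ : traceClass H,
    TopologicalSpace.induced (fun X : H →L[ℂ] H => trace ((ρ : H →L[ℂ] H) * X)) inferInstance

/-! ### Observables -/

/-- A discrete observable (POVM) with outcome set `Ω`: positive operators whose sum, in the weak
operator topology, is the identity. -/
structure Observable (Ω : Type*) (H : Type*) [NormedAddCommGroup H] [InnerProductSpace ℂ H]
    [CompleteSpace H] where
  effect : Ω → H →L[ℂ] H
  positive : ∀ x, (effect x).IsPositive
  sum_eq_one : ∀ φ ψ : H, HasSum (fun x => inner ℂ φ (effect x ψ)) (inner ℂ φ ψ)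

/-- Two observables commute if each effect of one commutes with each effect of the other. -/
def Observable.Commutes {Ω Ω' : Type*} (A : Observable Ω H) (B : Observable Ω' H) : Prop :=
  ∀ x y, A.effect x * B.effect y = B.effect y * A.effect x

/-- The σ-weak closure of the linear span of the effects of an observable. -/
def Observable.closedSpan {Ω : Type*} (B : Observable Ω H) : Set (H →L[ℂ] H) :=
  @closure (H →L[ℂ] H) (sigmaWeakTopology H) (Submodule.span ℂ (Set.range B.effect))

/-! ### Instruments -/

/-- Positivity of an `n × n` block matrix of operators, as an operator on `Hⁿ`. -/
def IsPosBlock {n : ℕ} (T : Matrix (Fin n) (Fin n) (H →L[ℂ] H)) : Prop :=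
  ∀ v : Fin n → H, 0 ≤ ∑ i, ∑ j, inner ℂ (v i) (T i j (v j))

/-- Complete positivity of a linear map on the trace class: for every `n`, applying the map to the
entries of `n × n` block matrices preserves positivity. -/
def IsCompletelyPositive (Ψ : traceClass H →ₗ[ℂ] traceClass H) : Prop :=
  ∀ (n : ℕ) (T : Matrix (Fin n) (Fin n) (traceClass H)),
    IsPosBlock (T.map fun S => (S : H →L[ℂ] H)) →
      IsPosBlock (T.map fun S => (Ψ S : H →L[ℂ] H))

/-- `Ψ* (X) = Z` for the adjoint `Ψ*` with respect to the trace duality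
`tr (X Ψ(Y)) = tr (Ψ*(X) Y)`, `Y` trace class. -/
def AdjointMapsTo (Ψ : traceClass H →ₗ[ℂ] traceClass H) (X Z : H →L[ℂ] H) : Prop :=
  ∀ Y : traceClass H, trace (X * (Ψ Y : H →L[ℂ] H)) = trace (Z * (Y : H →L[ℂ] H))

/-- `I` is an instrument that implements `A`: completely positive linear maps `Iₓ` on the trace
class with `Iₓ* (1) = Aₓ`. -/
def Implements {Ω : Type*} (I : Ω → traceClass H →ₗ[ℂ] traceClass H) (A : Observable Ω H) :
    Prop :=
  ∀ x, IsCompletelyPositive (I x) ∧ AdjointMapsTo (I x) 1 (A.effect x)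

/-- The instrument `I` does not disturb `B`: for each state `ρ` the output state
`σ = ∑ₓ Iₓ(ρ)` satisfies `tr (σ B_y) = tr (ρ B_y)` for all `y`. The convergence of the sum in trace
norm is automatic if `I` implements an observable. -/
def DoesNotDisturb {Ω Ω' : Type*} (I : Ω → traceClass H →ₗ[ℂ] traceClass H)
    (B : Observable Ω' H) : Prop :=
  ∀ ρ : traceClass H, IsState ρ → ∃ σ : traceClass H, HasTraceNormSum (fun x => I x ρ) σ ∧
    ∀ y, trace ((σ : H →L[ℂ] H) * B.effect y) = trace ((ρ : H →L[ℂ] H) * B.effect y)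

/-- `A` can be measured without disturbing `B`. -/
def Observable.MeasurableWithoutDisturbing {Ω Ω' : Type*} (A : Observable Ω H)
    (B : Observable Ω' H) : Prop :=
  ∃ I : Ω → traceClass H →ₗ[ℂ] traceClass H, Implements I A ∧ DoesNotDisturb I B

end

end QMeas

/-!
If `A` commutes with `B`, then the Lüders instrument `T ↦ √Aₓ T √Aₓ` measures `A` without disturbing
`B`, because `√Aₓ` commutes with `B_y` too, so that
`∑ₓ tr (√Aₓ ρ √Aₓ B_y) = ∑ₓ tr (ρ B_y Aₓ) = tr (ρ B_y)`. The trace norm convergence of the output is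
read off an explicit nuclear representation: a representation `ρ = ∑ₙ |pₙ⟩⟨qₙ|` produces the family
`(√Aₓ pₙ, √Aₓ qₙ)`, whose norms are summable over `(x, n)` by Cauchy–Schwarz.

Conversely, let `Iₓ` implement `A` without disturbing `B`, and write `X = B_y`. The channel
`∑ₓ Iₓ*` is unital and fixes every `B_y`, hence by σ-weak continuity it fixes `X²`, which lies in the
closed span (`DoesNotDisturb.hasSum_traceDuality_ketBra`). Complete positivity makes each defect
`X Iₓ*(1) X - X Iₓ*(X) - Iₓ*(X) X + Iₓ*(X²)` a positive operator; the defects sum to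
`X² - X² - X² + X² = 0`, so each of them vanishes. The defect is the value of a positive form on
pairs of vectors at `(X v, -v)`, so these vectors lie in the kernel of the form, which says
`Aₓ X = Iₓ*(X) = X Aₓ` (`IsCompletelyPositive.traceDuality_eq_of_defect_eq_zero`). This is the
multiplicative domain argument.

The dual maps `Iₓ*` are not constructed: they enter only through the numbers
`⟨v, Iₓ*(X) u⟩ = tr (X Iₓ(|u⟩⟨v|))`, that is, `traceDuality H X (I x (ketBra H u v))`.
-/

namespace QMeas

noncomputable section

set_option linter.unusedSectionVars false

open Filter Topology
open scoped ComplexOrder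

variable {H : Type*} [NormedAddCommGroup H] [InnerProductSpace ℂ H] [CompleteSpace H]

/-! ### Nuclear families and the trace -/

/-- Cauchy–Schwarz for infinite families, with the square sums bounded rather than evaluated. -/
theorem summable_mul_and_tsum_le {ι : Type*} {f g : ι → ℝ} {a b : ℝ} (hf : ∀ i, 0 ≤ f i)
    (hg : ∀ i, 0 ≤ g i) (ha : 0 ≤ a) (hb : 0 ≤ b) (hfa : ∀ s : Finset ι, ∑ i ∈ s, f i ^ 2 ≤ a ^ 2)
    (hgb : ∀ s : Finset ι, ∑ i ∈ s, g i ^ 2 ≤ b ^ 2) :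
    Summable (fun i => f i * g i) ∧ ∑' i, f i * g i ≤ a * b := by
  have hn : ∀ i, 0 ≤ f i * g i := fun i => mul_nonneg (hf i) (hg i)
  have key : ∀ s : Finset ι, ∑ i ∈ s, f i * g i ≤ a * b := by
    intro s
    refine (Real.sum_mul_le_sqrt_mul_sqrt s f g).trans ?_
    exact mul_le_mul (Real.sqrt_le_iff.2 ⟨ha, hfa s⟩) (Real.sqrt_le_iff.2 ⟨hb, hgb s⟩)
      (Real.sqrt_nonneg _) ha
  exact ⟨summable_of_sum_le hn key, Real.tsum_le_of_sum_le hn key⟩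

/-- `T = ∑ₖ |pₖ⟩⟨qₖ|` with `∑ₖ ‖pₖ‖ ‖qₖ‖ < ∞`, over an arbitrary index type; for `ι = ℕ` this is
`IsNuclearRep`. -/
def IsNuclearFamily {ι : Type*} (T : H →L[ℂ] H) (p q : ι → H) : Prop :=
  Summable (fun k => ‖p k‖ * ‖q k‖) ∧ ∀ v : H, HasSum (fun k => inner ℂ (q k) v • p k) (T v)

theorem exists_isNuclearFamily (T : traceClass H) :
    ∃ p q : ℕ → H, IsNuclearFamily (T : H →L[ℂ] H) p q := T.2

theorem IsNuclearFamily.mul_left {ι : Type*} {T : H →L[ℂ] H} {p q : ι → H}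
    (h : IsNuclearFamily T p q) (X : H →L[ℂ] H) :
    IsNuclearFamily (X * T) (fun k => X (p k)) q := by
  refine ⟨?_, fun v => ?_⟩
  · refine Summable.of_nonneg_of_le (fun k => by positivity) (fun k => ?_) (h.1.mul_left ‖X‖)
    rw [← mul_assoc]
    gcongr
    exact X.le_opNorm _
  · simpa using (h.2 v).mapL X

theorem IsNuclearFamily.mul_right {ι : Type*} {T : H →L[ℂ] H} {p q : ι → H}
    (h : IsNuclearFamily T p q) (X : H →L[ℂ] H) :
    IsNuclearFamily (T * X) p (fun k => ContinuousLinearMap.adjoint X (q k)) := by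
  refine ⟨?_, fun v => ?_⟩
  · refine Summable.of_nonneg_of_le (fun k => by positivity) (fun k => ?_)
      (h.1.mul_left ‖ContinuousLinearMap.adjoint X‖)
    rw [mul_left_comm]
    gcongr
    exact ContinuousLinearMap.le_opNorm _ _
  · simpa [ContinuousLinearMap.adjoint_inner_left] using h.2 (X v)

/-- A countable nuclear family can be reindexed by `ℕ`, padding with zero vectors. -/
theorem IsNuclearFamily.exists_nat {ι : Type*} [Countable ι] {T : H →L[ℂ] H} {p q : ι → H}
    (h : IsNuclearFamily T p q) : ∃ x y : ℕ → H, IsNuclearRep T x y ∧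
      ∑' k, ‖p k‖ * ‖q k‖ = ∑' n, ‖x n‖ * ‖y n‖ := by
  obtain ⟨e, he⟩ := exists_injective_nat ι
  have h0 : ∀ n ∉ Set.range e, Function.extend e p 0 n = 0 := fun n hn =>
    Function.extend_apply' _ _ _ (by simpa using hn)
  have hs : HasSum (fun n => ‖Function.extend e p 0 n‖ * ‖Function.extend e q 0 n‖)
      (∑' k, ‖p k‖ * ‖q k‖) := by
    refine (he.hasSum_iff fun n hn => by simp [h0 n hn]).1 ?_
    simpa [Function.comp_def, he.extend_apply] using h.1.hasSum
  refine ⟨Function.extend e p 0, Function.extend e q 0, ⟨hs.summable, fun v => ?_⟩, hs.tsum_eq.symm⟩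
  refine (he.hasSum_iff fun n hn => by simp [h0 n hn]).1 ?_
  simpa [Function.comp_def, he.extend_apply] using h.2 v

theorem IsNuclearFamily.mem_traceClass {ι : Type*} [Countable ι] {T : H →L[ℂ] H} {p q : ι → H}
    (h : IsNuclearFamily T p q) : T ∈ traceClass H :=
  let ⟨x, y, hxy, _⟩ := h.exists_nat
  ⟨x, y, hxy⟩

theorem traceNorm_nonneg (T : traceClass H) : 0 ≤ traceNorm T := by
  refine Real.sInf_nonneg ?_
  rintro _ ⟨x, y, -, rfl⟩
  exact tsum_nonneg fun n => by positivity

theorem IsNuclearFamily.traceNorm_le {ι : Type*} [Countable ι] {T : traceClass H} {p q : ι → H}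
    (h : IsNuclearFamily (T : H →L[ℂ] H) p q) : traceNorm T ≤ ∑' k, ‖p k‖ * ‖q k‖ := by
  obtain ⟨x, y, hxy, he⟩ := h.exists_nat
  refine csInf_le ⟨0, ?_⟩ ⟨x, y, hxy, he⟩
  rintro _ ⟨x, y, -, rfl⟩
  exact tsum_nonneg fun n => by positivity

/-- Every norm summable family of rank one operators has a sum. -/
theorem exists_isNuclearFamily_of_summable {ι : Type*} {p q : ι → H}
    (h : Summable fun k => ‖p k‖ * ‖q k‖) : ∃ T : H →L[ℂ] H, IsNuclearFamily T p q := by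
  have hs : Summable fun k => InnerProductSpace.rankOne ℂ (p k) (q k) :=
    Summable.of_norm (by simpa using h)
  refine ⟨∑' k, InnerProductSpace.rankOne ℂ (p k) (q k), h, fun v => ?_⟩
  simpa using hs.hasSum.mapL (ContinuousLinearMap.apply ℂ H v)

/-- The diagonal sum of a nuclear operator over the fixed orthonormal basis, computed from a
nuclear family by exchanging the order of summation and Parseval's identity. -/
theorem IsNuclearFamily.hasSum_trace {ι : Type*} {T : H →L[ℂ] H} {p q : ι → H}
    (h : IsNuclearFamily T p q) :
    HasSum (fun i => inner ℂ (onb H i) (T (onb H i))) (∑' k, inner ℂ (q k) (p k)) := by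
  set e := onb H
  have hbes : ∀ (v : H) (s : Finset _), ∑ i ∈ s, ‖inner ℂ (e i) v‖ ^ 2 ≤ ‖v‖ ^ 2 :=
    fun v s => e.orthonormal.sum_inner_products_le v
  have hcs := fun k => summable_mul_and_tsum_le (f := fun i => ‖inner ℂ (e i) (p k)‖)
    (g := fun i => ‖inner ℂ (e i) (q k)‖) (fun _ => norm_nonneg _) (fun _ => norm_nonneg _)
    (norm_nonneg (p k)) (norm_nonneg (q k)) (hbes _) (hbes _)
  have hnorm : ∀ k i, ‖inner ℂ (q k) (e i) * inner ℂ (e i) (p k)‖ =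
      ‖inner ℂ (e i) (p k)‖ * ‖inner ℂ (e i) (q k)‖ := fun k i => by
    rw [norm_mul, mul_comm, norm_inner_symm (q k)]
  have hS : Summable fun z : ι × _ => inner ℂ (q z.1) (e z.2) * inner ℂ (e z.2) (p z.1) := by
    refine Summable.of_norm ((summable_prod_of_nonneg fun _ => norm_nonneg _).2 ⟨fun k => ?_, ?_⟩)
    · simpa only [hnorm] using (hcs k).1
    · simp only [hnorm]
      exact Summable.of_nonneg_of_le (fun k => tsum_nonneg fun i => by positivity)
        (fun k => (hcs k).2) h.1
  have h1 := hS.hasSum.prod_fiberwise fun k => e.hasSum_inner_mul_inner (q k) (p k)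
  rw [h1.tsum_eq]
  refine ((Equiv.prodComm _ _).hasSum_iff.2 hS.hasSum).prod_fiberwise fun i => ?_
  simpa [inner_smul_right] using (h.2 (e i)).mapL (innerSL ℂ (e i))

theorem IsNuclearFamily.trace_eq {ι : Type*} {T : H →L[ℂ] H} {p q : ι → H}
    (h : IsNuclearFamily T p q) : trace T = ∑' k, inner ℂ (q k) (p k) :=
  h.hasSum_trace.tsum_eq

theorem IsNuclearFamily.summable_inner {ι : Type*} {T : H →L[ℂ] H} {p q : ι → H}
    (h : IsNuclearFamily T p q) : Summable fun k => (inner ℂ (q k) (p k) : ℂ) :=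
  Summable.of_norm_bounded h.1 fun k => by
    rw [mul_comm]
    exact norm_inner_le_norm _ _

/-- Cyclicity of the trace for a bounded and a trace class operator. -/
theorem trace_mul_comm (X : H →L[ℂ] H) (T : traceClass H) :
    trace (X * (T : H →L[ℂ] H)) = trace ((T : H →L[ℂ] H) * X) := by
  obtain ⟨p, q, h⟩ := exists_isNuclearFamily T
  rw [(h.mul_left X).trace_eq, (h.mul_right X).trace_eq]
  simp [ContinuousLinearMap.adjoint_inner_left]

theorem norm_trace_mul_le (X : H →L[ℂ] H) (T : traceClass H) :
    ‖trace (X * (T : H →L[ℂ] H))‖ ≤ ‖X‖ * traceNorm T := by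
  have key : ∀ x y : ℕ → H, IsNuclearRep (T : H →L[ℂ] H) x y →
      ‖trace (X * (T : H →L[ℂ] H))‖ ≤ ‖X‖ * ∑' n, ‖x n‖ * ‖y n‖ := by
    intro x y h
    have h' : IsNuclearFamily (T : H →L[ℂ] H) x y := h
    rw [(h'.mul_left X).trace_eq, ← tsum_mul_left]
    refine tsum_of_norm_bounded (h.1.mul_left ‖X‖).hasSum fun n => ?_
    calc ‖(inner ℂ (y n) (X (x n)) : ℂ)‖ ≤ ‖y n‖ * ‖X (x n)‖ := norm_inner_le_norm _ _
      _ ≤ ‖y n‖ * (‖X‖ * ‖x n‖) := by gcongr; exact X.le_opNorm _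
      _ = ‖X‖ * (‖x n‖ * ‖y n‖) := by ring
  obtain ⟨x₀, y₀, h₀⟩ := T.2
  rcases (norm_nonneg X).eq_or_lt with hX | hX
  · simpa [← hX] using key x₀ y₀ h₀
  · rw [← div_le_iff₀' hX]
    refine le_csInf ⟨_, x₀, y₀, h₀, rfl⟩ ?_
    rintro _ ⟨x, y, h, rfl⟩
    exact (div_le_iff₀' hX).2 (key x y h)

/-- The trace duality `(X, T) ↦ tr (X T)` between bounded and trace class operators. -/
def traceDuality (H : Type*) [NormedAddCommGroup H] [InnerProductSpace ℂ H] [CompleteSpace H] :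
    (H →L[ℂ] H) →ₗ[ℂ] traceClass H →ₗ[ℂ] ℂ :=
  have hsum (X : H →L[ℂ] H) (T : traceClass H) :
      Summable fun i => inner ℂ (onb H i) ((X * (T : H →L[ℂ] H)) (onb H i)) := by
    obtain ⟨p, q, h⟩ := exists_isNuclearFamily T
    exact (h.mul_left X).hasSum_trace.summable
  LinearMap.mk₂ ℂ (fun X T => trace (X * (T : H →L[ℂ] H)))
    (fun X Y T => by
      simpa [trace, add_mul, inner_add_right] using (hsum X T).tsum_add (hsum Y T))
    (fun c X T => by simp [trace, tsum_mul_left])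
    (fun X S T => by
      simpa [trace, mul_add, inner_add_right] using (hsum X S).tsum_add (hsum X T))
    (fun c X T => by simp [trace, tsum_mul_left])

theorem traceDuality_apply (X : H →L[ℂ] H) (T : traceClass H) :
    traceDuality H X T = trace (X * (T : H →L[ℂ] H)) := rfl

theorem HasTraceNormSum.hasSum_traceDuality {Ω : Type*} {f : Ω → traceClass H} {σ : traceClass H}
    (h : HasTraceNormSum f σ) (X : H →L[ℂ] H) :
    HasSum (fun x => traceDuality H X (f x)) (traceDuality H X σ) := by
  rw [HasSum, SummationFilter.unconditional_filter, tendsto_iff_norm_sub_tendsto_zero]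
  refine squeeze_zero (fun _ => norm_nonneg _) (fun s => ?_) (by simpa using h.const_mul ‖X‖)
  rw [norm_sub_rev, ← map_sum, ← map_sub]
  exact norm_trace_mul_le X _

/-! ### Rank one operators -/

/-- The rank one operator `|u⟩⟨v|` as a trace class operator, conjugate-linear in `v`. -/
def ketBra (H : Type*) [NormedAddCommGroup H] [InnerProductSpace ℂ H] [CompleteSpace H] :
    H →ₗ[ℂ] H →ₗ⋆[ℂ] traceClass H :=
  LinearMap.mk₂'ₛₗ (RingHom.id ℂ) (starRingEnd ℂ)
    (fun u v => ⟨InnerProductSpace.rankOne ℂ u v,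
      IsNuclearFamily.mem_traceClass (p := fun _ : Unit => u) (q := fun _ => v)
        ⟨(hasSum_unique _).summable, fun w => by simp⟩⟩)
    (fun _ _ _ => Subtype.ext (by simp)) (fun _ _ _ => Subtype.ext (by simp))
    (fun _ _ _ => Subtype.ext (by simp)) (fun _ _ _ => Subtype.ext (by simp))

@[simp] theorem coe_ketBra_apply (u v w : H) :
    (ketBra H u v : H →L[ℂ] H) w = inner ℂ v w • u := rfl

theorem traceDuality_ketBra (X : H →L[ℂ] H) (u v : H) :
    traceDuality H X (ketBra H u v) = inner ℂ v (X u) := by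
  have h : IsNuclearFamily (ketBra H u v : H →L[ℂ] H) (fun _ : Unit => u) (fun _ => v) :=
    ⟨(hasSum_unique _).summable, fun w => by simp⟩
  rw [traceDuality_apply, (h.mul_left X).trace_eq, tsum_const]
  simp

/-- Polarization: operators of the form `|w⟩⟨w|` span all rank one operators. -/
theorem ketBra_polarization (u v : H) :
    ketBra H u v = (1 / 4 : ℂ) • (ketBra H (u + v) (u + v) - ketBra H (u - v) (u - v)
      + Complex.I • ketBra H (u + Complex.I • v) (u + Complex.I • v)
      - Complex.I • ketBra H (u - Complex.I • v) (u - Complex.I • v)) := by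
  simp only [map_add, map_sub, LinearMap.add_apply, LinearMap.sub_apply, map_smul,
    LinearMap.map_smulₛₗ, LinearMap.smul_apply, Complex.conj_I]
  match_scalars <;> ring_nf <;> simp; norm_num

/-! ### Non-disturbance on the σ-weak closure -/

theorem continuous_traceDuality_left (T : traceClass H) :
    Continuous[sigmaWeakTopology H, inferInstance] fun X => traceDuality H X T := by
  simp only [traceDuality_apply, trace_mul_comm]
  exact continuous_iInf_dom (i := T) continuous_induced_dom

/-- Agreement of two trace class operators on the effects of `B` extends to the σ-weak closure of
their span. -/
theorem Observable.traceDuality_eq_of_mem_closedSpan {Ω : Type*} (B : Observable Ω H)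
    {S T : traceClass H} (h : ∀ y, traceDuality H (B.effect y) S = traceDuality H (B.effect y) T)
    {X : H →L[ℂ] H} (hX : X ∈ B.closedSpan) : traceDuality H X S = traceDuality H X T := by
  let := sigmaWeakTopology H
  refine closure_minimal (t := {X | traceDuality H X S = traceDuality H X T}) (fun Y hY => ?_)
    (isClosed_eq (continuous_traceDuality_left S) (continuous_traceDuality_left T)) hX
  exact LinearMap.eqOn_span (f := (traceDuality H).flip S) (g := (traceDuality H).flip T)
    (by rintro _ ⟨y, rfl⟩; exact h y) hY

theorem isState_smul_ketBra_self {w : H} (hw : w ≠ 0) :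
    IsState (((‖w‖ ^ 2)⁻¹ : ℂ) • ketBra H w w) := by
  have hw' : (‖w‖ : ℂ) ≠ 0 := by simpa using hw
  refine ⟨?_, ?_⟩
  · refine (InnerProductSpace.isPositive_rankOne_self w).smul_of_nonneg ?_
    rw [← Complex.ofReal_pow, ← Complex.ofReal_inv]
    exact Complex.zero_le_real.2 (by positivity)
  · have := traceDuality_ketBra (1 : H →L[ℂ] H) w w
    rw [traceDuality_apply, one_mul] at this
    have h2 := map_smul (traceDuality H 1) ((‖w‖ ^ 2)⁻¹ : ℂ) (ketBra H w w)
    rw [traceDuality_apply, traceDuality_apply, one_mul, one_mul, this] at h2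
    rw [h2]
    simp [inner_self_eq_norm_sq_to_K, hw']

/-- In the Heisenberg picture: an instrument that does not disturb `B` fixes the σ-weakly closed
span of `B`. It is enough to test this on rank one operators, which polarization reduces to pure
states. -/
theorem DoesNotDisturb.hasSum_traceDuality_ketBra {Ω Ω' : Type*}
    {I : Ω → traceClass H →ₗ[ℂ] traceClass H} {B : Observable Ω' H} (h : DoesNotDisturb I B)
    {X : H →L[ℂ] H} (hX : X ∈ B.closedSpan) (u v : H) :
    HasSum (fun x => traceDuality H X (I x (ketBra H u v))) (inner ℂ v (X u)) := by
  rw [← traceDuality_ketBra]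
  have hself : ∀ w : H, HasSum (fun x => traceDuality H X (I x (ketBra H w w)))
      (traceDuality H X (ketBra H w w)) := by
    intro w
    rcases eq_or_ne w 0 with rfl | hw
    · simp
    obtain ⟨σ, hσ, hB⟩ := h _ (isState_smul_ketBra_self hw)
    have hfix := B.traceDuality_eq_of_mem_closedSpan (S := σ)
      (fun y => by simpa only [traceDuality_apply, trace_mul_comm] using hB y) hX
    have hw' : (‖w‖ ^ 2 : ℂ) ≠ 0 := by simpa using hw
    have := (hσ.hasSum_traceDuality X).mul_left (‖w‖ ^ 2 : ℂ)
    rw [hfix] at this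
    simpa [hw', mul_inv_cancel_left₀] using this
  have hsum := ((((hself (u + v)).sub (hself (u - v))).add
    ((hself (u + Complex.I • v)).mul_left Complex.I)).sub
    ((hself (u - Complex.I • v)).mul_left Complex.I)).mul_left (1 / 4 : ℂ)
  rw [ketBra_polarization u v]
  simp only [map_smul (I _), map_sub (I _), map_add (I _), map_smul (traceDuality H X),
    map_sub (traceDuality H X), map_add (traceDuality H X), smul_eq_mul]
  exact hsum

/-! ### The multiplicative domain argument -/

/-- Complete positivity of the dual map, in the form `∑ᵢⱼ ⟨uⱼ, Ψ*(Xⱼ* Xᵢ) uᵢ⟩ ≥ 0`. -/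
theorem IsCompletelyPositive.sum_traceDuality_nonneg {Ψ : traceClass H →ₗ[ℂ] traceClass H}
    (h : IsCompletelyPositive Ψ) {n : ℕ} (X : Fin n → H →L[ℂ] H) (u : Fin n → H) :
    0 ≤ ∑ i, ∑ j, traceDuality H (ContinuousLinearMap.adjoint (X j) * X i)
      (Ψ (ketBra H (u i) (u j))) := by
  have hpos := h n (.of fun i j => ketBra H (u i) (u j)) fun v => by
    have hsq : ∑ i, ∑ j, inner ℂ (v i) (inner ℂ (u j) (v j) • u i) =
        (∑ i, inner ℂ (v i) (u i)) * starRingEnd ℂ (∑ i, inner ℂ (v i) (u i)) := by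
      rw [map_sum, Finset.sum_mul_sum]
      refine Finset.sum_congr rfl fun i _ => Finset.sum_congr rfl fun j _ => ?_
      rw [inner_smul_right, inner_conj_symm, mul_comm]
    refine le_of_le_of_eq ?_ hsq.symm
    rw [Complex.mul_conj]
    exact Complex.zero_le_real.2 (Complex.normSq_nonneg _)
  -- By cyclicity each term is `tr (Xᵢ Ψ(|uᵢ⟩⟨uⱼ|) Xⱼ*)`, a sum over the orthonormal basis.
  have hterm : ∀ i j, HasSum (fun k => inner ℂ (ContinuousLinearMap.adjoint (X i) (onb H k))
      ((Ψ (ketBra H (u i) (u j)) : H →L[ℂ] H) (ContinuousLinearMap.adjoint (X j) (onb H k))))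
      (traceDuality H (ContinuousLinearMap.adjoint (X j) * X i) (Ψ (ketBra H (u i) (u j)))) := by
    intro i j
    obtain ⟨p, q, hpq⟩ := exists_isNuclearFamily (Ψ (ketBra H (u i) (u j)))
    have h1 := ((hpq.mul_left (X i)).mul_right (ContinuousLinearMap.adjoint (X j))).hasSum_trace
    rw [traceDuality_apply, (hpq.mul_left _).trace_eq]
    simpa [ContinuousLinearMap.adjoint_inner_left, ContinuousLinearMap.adjoint_inner_right]
      using h1
  exact (hasSum_sum fun i _ => hasSum_sum fun j _ => hterm i j).nonneg fun k => by
    simpa using hpos fun i => ContinuousLinearMap.adjoint (X i) (onb H k)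

/-- A nonnegative polynomial `t a + t̄ b + c` in `t`, `t̄` is constant. -/
theorem eq_zero_of_forall_nonneg {a b c : ℂ}
    (h : ∀ t : ℂ, 0 ≤ t * a + starRingEnd ℂ t * b + c) : a = 0 ∧ b = 0 := by
  have hreal : ∀ d : ℂ, (∀ r : ℝ, 0 ≤ (r : ℂ) * d + c) → d = 0 := by
    intro d hd
    have him : ∀ r : ℝ, r * d.im + c.im = 0 := fun r => by
      simpa using (Complex.le_def.1 (hd r)).2.symm
    have hre : ∀ r : ℝ, 0 ≤ r * d.re + c.re := fun r => by
      simpa using (Complex.le_def.1 (hd r)).1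
    refine Complex.ext ?_ ?_
    · by_contra hne
      have := hre (-(c.re + 1) / d.re)
      rw [div_mul_cancel₀ _ hne] at this
      linarith
    · have h0 := him 0
      have h1 := him 1
      simp only [Complex.zero_im]
      linarith
  have h1 : a + b = 0 := hreal _ fun r => by simpa [mul_add] using h r
  have h2 : Complex.I * (a - b) = 0 := hreal _ fun r => by
    have := h (r * Complex.I)
    simp only [map_mul, Complex.conj_I, Complex.conj_ofReal] at this
    convert this using 1
    ring
  have h3 : a - b = 0 := by simpa using h2
  exact ⟨by linear_combination (h1 + h3) / 2, by linear_combination (h1 - h3) / 2⟩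

/-- For completely positive `Ψ` and self-adjoint `X`, if
`⟨v, (X Ψ*(1) X - X Ψ*(X) - Ψ*(X) X + Ψ*(X²)) v⟩ = 0` then `(Ψ*(1) X - Ψ*(X)) v = 0`, weakly, and
likewise for the adjoint: a null vector of a positive form lies in its kernel. -/
theorem IsCompletelyPositive.traceDuality_eq_of_defect_eq_zero
    {Ψ : traceClass H →ₗ[ℂ] traceClass H} (h : IsCompletelyPositive Ψ) {X : H →L[ℂ] H}
    (hX : IsSelfAdjoint X) {v : H}
    (hv : traceDuality H 1 (Ψ (ketBra H (X v) (X v))) - traceDuality H X (Ψ (ketBra H (X v) v))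
      - traceDuality H X (Ψ (ketBra H v (X v))) + traceDuality H (X * X) (Ψ (ketBra H v v)) = 0)
    (w : H) :
    traceDuality H 1 (Ψ (ketBra H (X v) w)) = traceDuality H X (Ψ (ketBra H v w)) ∧
    traceDuality H 1 (Ψ (ketBra H w (X v))) = traceDuality H X (Ψ (ketBra H w v)) := by
  have hadj : ContinuousLinearMap.adjoint X = X := hX
  have hone : ContinuousLinearMap.adjoint (1 : H →L[ℂ] H) = 1 :=
    (ContinuousLinearMap.star_eq_adjoint _).symm.trans (star_one _)
  have key := eq_zero_of_forall_nonneg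
    (a := traceDuality H 1 (Ψ (ketBra H (X v) w)) - traceDuality H X (Ψ (ketBra H v w)))
    (b := traceDuality H 1 (Ψ (ketBra H w (X v))) - traceDuality H X (Ψ (ketBra H w v)))
    (c := traceDuality H 1 (Ψ (ketBra H w w))) fun t => by
      have := h.sum_traceDuality_nonneg ![1, X] ![t • X v + w, -(t • v)]
      simp only [Fin.sum_univ_two, Matrix.cons_val_zero, Matrix.cons_val_one, hadj, hone, mul_one,
        one_mul, map_add, map_neg, LinearMap.add_apply, LinearMap.neg_apply, map_smul,
        LinearMap.map_smulₛₗ, LinearMap.smul_apply, smul_eq_mul] at this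
      convert this using 1
      linear_combination -(t * starRingEnd ℂ t) * hv
  exact ⟨sub_eq_zero.1 key.1, sub_eq_zero.1 key.2⟩

theorem Observable.MeasurableWithoutDisturbing.commutes {Ω Ω' : Type*} {A : Observable Ω H}
    {B : Observable Ω' H} (h : A.MeasurableWithoutDisturbing B)
    (hB : ∀ y, B.effect y * B.effect y ∈ B.closedSpan) : A.Commutes B := by
  obtain ⟨I, hI, hD⟩ := h
  intro x y
  set X := B.effect y
  have hX : IsSelfAdjoint X := (B.positive y).isSelfAdjoint
  have hsym : ∀ u w : H, inner ℂ (X u) w = inner ℂ u (X w) := (B.positive y).isSymmetric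
  have hmem : X ∈ B.closedSpan :=
    @subset_closure _ (sigmaWeakTopology H) _ _ (Submodule.subset_span ⟨y, rfl⟩)
  have hone : ∀ x u w, traceDuality H 1 (I x (ketBra H u w)) = inner ℂ w (A.effect x u) :=
    fun x u w => ((hI x).2 _).trans (traceDuality_ketBra _ _ _)
  have hker : ∀ x v w, _ := fun x v w =>
    (hI x).1.traceDuality_eq_of_defect_eq_zero hX (v := v) (w := w) <| by
    -- The defects of the single outcomes are nonnegative and add up to
    -- `⟨v, (X² - X² - X² + X²) v⟩`.
    have hsum : HasSum (fun x => traceDuality H 1 (I x (ketBra H (X v) (X v)))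
        - traceDuality H X (I x (ketBra H (X v) v)) - traceDuality H X (I x (ketBra H v (X v)))
        + traceDuality H (X * X) (I x (ketBra H v v))) 0 := by
      simp only [hone]
      have hadd := (((A.sum_eq_one (X v) (X v)).sub
        (hD.hasSum_traceDuality_ketBra hmem (X v) v)).sub
        (hD.hasSum_traceDuality_ketBra hmem v (X v))).add
        (hD.hasSum_traceDuality_ketBra (hB y) v v)
      have hzero : inner ℂ (X v) (X v) - inner ℂ v (X (X v)) - inner ℂ (X v) (X v)
          + inner ℂ v ((X * X) v) = 0 := by
        rw [mul_apply_eq_comp]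
        ring
      rwa [hzero] at hadd
    refine (hasSum_zero_iff_of_nonneg fun x => ?_).1 hsum |> fun h => congrFun h x
    have := (hI x).1.sum_traceDuality_nonneg ![1, X] ![X v, -v]
    simpa [Fin.sum_univ_two, hX.star_eq, ← ContinuousLinearMap.star_eq_adjoint, sub_eq_add_neg,
      add_assoc] using this
  ext v
  refine ext_inner_left ℂ fun w => ?_
  have h1 := (hker x v w).1
  have h2 := (hker x w v).2
  rw [hone] at h1 h2
  exact (h1.trans h2.symm).trans (hsym w _)

/-! ### The Lüders instrument -/

/-- The map `T ↦ K T K` on the trace class. -/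
def conjugation (K : H →L[ℂ] H) : traceClass H →ₗ[ℂ] traceClass H where
  toFun T := ⟨K * (T : H →L[ℂ] H) * K, by
    obtain ⟨p, q, h⟩ := exists_isNuclearFamily T
    exact ((h.mul_left K).mul_right K).mem_traceClass⟩
  map_add' S T := Subtype.ext (by simp [mul_add, add_mul])
  map_smul' c T := Subtype.ext (by simp)

theorem coe_conjugation (K : H →L[ℂ] H) (T : traceClass H) :
    (conjugation K T : H →L[ℂ] H) = K * (T : H →L[ℂ] H) * K := rfl

theorem isCompletelyPositive_conjugation {K : H →L[ℂ] H} (hK : IsSelfAdjoint K) :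
    IsCompletelyPositive (conjugation K) := by
  have hsym : ∀ u w : H, inner ℂ (K u) w = inner ℂ u (K w) := hK.isSymmetric
  intro n T hT v
  simpa [coe_conjugation, hsym] using hT fun i => K (v i)

theorem adjointMapsTo_conjugation (K : H →L[ℂ] H) : AdjointMapsTo (conjugation K) 1 (K * K) := by
  intro T
  obtain ⟨p, q, h⟩ := exists_isNuclearFamily T
  let S : traceClass H := ⟨K * T, (h.mul_left K).mem_traceClass⟩
  rw [one_mul, coe_conjugation, mul_assoc K K]
  exact (trace_mul_comm K S).symm

theorem exists_isSelfAdjoint_mul_self_eq {T : H →L[ℂ] H} (hT : T.IsPositive) :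
    ∃ K : H →L[ℂ] H, IsSelfAdjoint K ∧ K * K = T ∧ ∀ X, Commute T X → Commute K X := by
  have h0 : 0 ≤ T := (ContinuousLinearMap.nonneg_iff_isPositive T).2 hT
  exact ⟨CFC.sqrt T, .of_nonneg (CFC.sqrt_nonneg T), CFC.sqrt_mul_sqrt_self T h0,
    fun X hX => Commute.cfcₙ_nnreal hX _⟩

/-- Removing finitely many fibres from a sum over a product. -/
theorem hasSum_sub_fibers {α β E : Type*} [NormedAddCommGroup E] [DecidableEq α] {f : α × β → E}
    {F : E} {g : α → E} (hf : HasSum f F) (hg : ∀ a, HasSum (fun b => f (a, b)) (g a))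
    (s : Finset α) :
    HasSum (fun z : α × β => if z.1 ∈ s then 0 else f z) (F - ∑ a ∈ s, g a) := by
  have hfib : ∀ a ∈ s, HasSum (fun z : α × β => if z.1 = a then f z else 0) (g a) := by
    intro a _
    refine ((Prod.mk_right_injective a).hasSum_iff fun z hz => if_neg ?_).1 ?_
    · rintro rfl
      exact hz ⟨z.2, rfl⟩
    · simpa [Function.comp_def] using hg a
  refine (hf.sub (hasSum_sum hfib)).congr_fun fun z => ?_
  by_cases hz : z.1 ∈ s <;> simp [hz]

/-- Commuting observables: the Lüders instrument `T ↦ √Aₓ T √Aₓ` does not disturb `B`. A nuclear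
family `(p, q)` for `ρ` gives the nuclear family `(√Aₓ pₙ, √Aₓ qₙ)` over pairs `(x, n)` for the
output, which is norm summable by Cauchy–Schwarz and `∑ₓ ‖√Aₓ v‖² = ‖v‖²`. -/
theorem Observable.Commutes.measurableWithoutDisturbing {Ω Ω' : Type*} [Countable Ω]
    {A : Observable Ω H} {B : Observable Ω' H} (h : A.Commutes B) :
    A.MeasurableWithoutDisturbing B := by
  classical
  choose K hK hKA hKc using fun x => exists_isSelfAdjoint_mul_self_eq (A.positive x)
  have hsym : ∀ x (u w : H), inner ℂ (K x u) w = inner ℂ u (K x w) := fun x => (hK x).isSymmetric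
  have hKK : ∀ x v, K x (K x v) = A.effect x v := fun x v => by rw [← hKA]; rfl
  refine ⟨fun x => conjugation (K x), fun x => ⟨isCompletelyPositive_conjugation (hK x), ?_⟩,
    fun ρ _ => ?_⟩
  · simpa only [hKA] using adjointMapsTo_conjugation (K x)
  obtain ⟨p, q, hpq⟩ := exists_isNuclearFamily ρ
  have hbes : ∀ (v : H) (s : Finset Ω), ∑ x ∈ s, ‖K x v‖ ^ 2 ≤ ‖v‖ ^ 2 := by
    intro v s
    have hs : HasSum (fun x => ‖K x v‖ ^ 2) (‖v‖ ^ 2) := by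
      have := (A.sum_eq_one v v).mapL Complex.reCLM
      simpa [← hKK, ← hsym, inner_self_eq_norm_sq_to_K, ← Complex.ofReal_pow] using this
    exact sum_le_hasSum s (fun x _ => by positivity) hs
  have hcs := fun n => summable_mul_and_tsum_le (f := fun x => ‖K x (p n)‖)
    (g := fun x => ‖K x (q n)‖) (fun _ => norm_nonneg _) (fun _ => norm_nonneg _)
    (norm_nonneg (p n)) (norm_nonneg (q n)) (hbes _) (hbes _)
  have hS : Summable fun z : Ω × ℕ => ‖K z.1 (p z.2)‖ * ‖K z.1 (q z.2)‖ := by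
    refine (Equiv.prodComm ℕ Ω).summable_iff.1
      ((summable_prod_of_nonneg fun _ => mul_nonneg (norm_nonneg _) (norm_nonneg _)).2 ⟨fun n => (hcs n).1, ?_⟩)
    exact Summable.of_nonneg_of_le (fun n => tsum_nonneg fun x => mul_nonneg (norm_nonneg _) (norm_nonneg _))
      (fun n => (hcs n).2) hpq.1
  obtain ⟨S, hfam⟩ := exists_isNuclearFamily_of_summable hS
  refine ⟨⟨S, hfam.mem_traceClass⟩, ?_, fun y => ?_⟩
  · have hx : ∀ x, IsNuclearFamily (conjugation (K x) ρ : H →L[ℂ] H) (fun n => K x (p n))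
        (fun n => K x (q n)) := fun x => by
      simpa [coe_conjugation, (hK x).adjoint_eq] using (hpq.mul_left (K x)).mul_right (K x)
    have hrest : ∀ s : Finset Ω, traceNorm (⟨S, hfam.mem_traceClass⟩ -
        ∑ x ∈ s, conjugation (K x) ρ) ≤ (∑' z : Ω × ℕ, ‖K z.1 (p z.2)‖ * ‖K z.1 (q z.2)‖) -
        ∑ x ∈ s, ∑' n, ‖K x (p n)‖ * ‖K x (q n)‖ := by
      intro s
      have hnorm := hasSum_sub_fibers hS.hasSum (fun x => (hx x).1.hasSum) s
      rw [← hnorm.tsum_eq]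
      have : IsNuclearFamily ((⟨S, hfam.mem_traceClass⟩ - ∑ x ∈ s, conjugation (K x) ρ :
          traceClass H) : H →L[ℂ] H) (fun z : Ω × ℕ => if z.1 ∈ s then 0 else K z.1 (p z.2))
          (fun z => K z.1 (q z.2)) := by
        refine ⟨hnorm.summable.congr fun z => ?_, fun v => ?_⟩
        · by_cases hz : z.1 ∈ s <;> simp [hz]
        · have := hasSum_sub_fibers (hfam.2 v) (fun x => (hx x).2 v) s
          simpa using this.congr_fun fun z => by split_ifs <;> simp
      refine this.traceNorm_le.trans_eq (tsum_congr fun z => ?_)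
      by_cases hz : z.1 ∈ s <;> simp [hz]
    have hlim : HasSum (fun x => ∑' n, ‖K x (p n)‖ * ‖K x (q n)‖)
        (∑' z : Ω × ℕ, ‖K z.1 (p z.2)‖ * ‖K z.1 (q z.2)‖) :=
      hS.hasSum.prod_fiberwise fun x => (hx x).1.hasSum
    refine squeeze_zero (fun s => traceNorm_nonneg _) hrest ?_
    simpa using hlim.const_sub (∑' z : Ω × ℕ, ‖K z.1 (p z.2)‖ * ‖K z.1 (q z.2)‖)
  · -- Summing over `x` first uses `√Aₓ B_y √Aₓ = Aₓ B_y` and `∑ₓ Aₓ = 1`.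
    rw [← trace_mul_comm, ← trace_mul_comm, (hfam.mul_left _).trace_eq, (hpq.mul_left _).trace_eq]
    have hsum := ((Equiv.prodComm ℕ Ω).hasSum_iff.2
      (hfam.mul_left (B.effect y)).summable_inner.hasSum).prod_fiberwise
      (g := fun n => inner ℂ (q n) (B.effect y (p n))) fun n => by
        refine (A.sum_eq_one (q n) (B.effect y (p n))).congr_fun fun x => ?_
        have hc : K x (B.effect y (K x (p n))) = A.effect x (B.effect y (p n)) := by
          rw [← hKK]
          exact congrArg (K x) (DFunLike.congr_fun (hKc x _ (h x y)).eq (p n)).symm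
        simp [hsym, hc]
    exact hsum.tsum_eq.symm

end

end QMeas

theorem proposition3p2 {H : Type*} [NormedAddCommGroup H] [InnerProductSpace ℂ H]
    [CompleteSpace H] [TopologicalSpace.SeparableSpace H]
    {ΩA ΩB : Type*} [Countable ΩA] [Countable ΩB]
    (B : QMeas.Observable ΩB H)
    (hB : ∀ y, B.effect y * B.effect y ∈ B.closedSpan)
    (A : QMeas.Observable ΩA H) :
    A.MeasurableWithoutDisturbing B ↔ A.Commutes B :=
  ⟨fun h => h.commutes hB, fun h => h.measurableWithoutDisturbing⟩
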